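/- Let $d, r \ge 0$ be integers. For an integrable $p$ on $\mathbb{R}^d$ put $\widehat p(s) = \int e^{-i s^\top x} p(x)\,dx$. A density $p$ is upper-supersmooth of order $\alpha$ with constants $C, C_1 > 0$ if $|\widehat p(s)| \le C \exp(-C_1 \sum_{j=1}^d |s_j|^{\alpha})$ for all $s \in \mathbb{R}^d$, and lower-supersmooth of order $\alpha$ with constants $c, C_2 > 0$ if $|\widehat p(s)| \ge c \exp(-C_2 \sum_{j=1}^d |s_j|^{\alpha})$ for all $s \in \mathbb{R}^d$. Let $\Theta \subseteq \mathbb{R}^d$ be a measurable set on which derivatives are well defined (it has unique differentials at each of its points, and every neighbourhood of every point of $\Theta$ meets $\Theta$ in positive measure; e.g. $\Theta$ open, or convex with nonempty interior). Let $0 < \alpha_1 \le \alpha_2$. Let $f$ be a probability density on $\mathbb{R}^d$ with $f(-x) = f(x)$ for all $x$, lower-supersmooth of order $\alpha_1$ with constants $c, C_2$. Let $g$ be a probability density on $\mathbb{R}^d$ vanishing outside $\Theta$, with $\|g\|_\infty < \infty$, upper-supersmooth of order $\alpha_2$ with constants $C, C_1$, and $g \in \mathcal{C}^r(\Theta)$,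 that is, on $\Theta$ the function $g$ has continuous, bounded and integrable derivatives up to order $r$. Let $n \ge 1$, let $X_1, \dots, X_n$ be i.i.d. with density $p_0(x) = \int_\Theta f(x - \theta) g(\theta)\,d\theta$, and for $\theta \in \mathbb{R}^d$ let $$\widehat g_{n,R}(\theta) = \frac{1}{n (2\pi)^d} \sum_{j=1}^n \int_{[-R,R]^d} \frac{\cos(s^\top(\theta - X_j))}{\widehat f(s)}\,ds .$$ Write $\nabla^i h$ for the tensor of all partial derivatives of order $i$ of $h$, $\|\cdot\|_{\max}$ for the maximum of the absolute values of its entries and $\|\cdot\|$ for the Euclidean norm of its entries. Then there are constants $C' > 0$, $C'_i$ and $\bar C_i$ ($1 \le i \le r$), depending only on $d, r, \alpha_1, \alpha_2, C, C_1, c, C_2$ (hence not on $n$, $R$, $\theta$), such that for all $R \ge C'$ and all $1 \le i \le r$ the estimator $\widehat g_{n,R}$ is $i$ times continuously differentiable, the expectations below exist, and $$\sup_{\theta \in \Theta} \bigl\| \mathbb{E}[\nabla^i \widehat g_{n,R}(\theta)] - \nabla^i g(\theta) \bigr\|_{\max} \le C'_i\, R^{\max\{i + 1 - \alpha_2,\,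 0\}} \exp(-C_1 R^{\alpha_2}),$$ $$\sup_{\theta \in \Theta} \mathbb{E}\Bigl[ \bigl\| \nabla^i \widehat g_{n,R}(\theta) - \mathbb{E}[\nabla^i \widehat g_{n,R}(\theta)] \bigr\|^2 \Bigr] \le \bar C_i\, \frac{R^{2(i+d)} \exp(2 C_2 d R^{\alpha_1})}{n}.$$ -/

import Mathlib

open MeasureTheory ProbabilityTheory Topology

noncomputable section

/-- A probability density function on `ℝ^d` (with respect to Lebesgue measure). -/
structure IsDensity {d : ℕ} (p : EuclideanSpace ℝ (Fin d) → ℝ) : Prop where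
  nonneg : ∀ x, 0 ≤ p x
  integrable : Integrable p volume
  integral_eq_one : ∫ x, p x = 1

/-- The Fourier transform `p̂(s) = ∫ exp(-i sᵀx) p(x) dx`. -/
def fourierHat {d : ℕ} (p : EuclideanSpace ℝ (Fin d) → ℝ) (s : EuclideanSpace ℝ (Fin d)) : ℂ :=
  ∫ x, Complex.exp (-(Complex.I * ((inner ℝ s x : ℝ) : ℂ))) * (p x : ℂ)

/-- `p` is upper-supersmooth of order `α` with associated constants `C` and `C₁`. -/
structure IsUpperSupersmooth {d : ℕ} (p : EuclideanSpace ℝ (Fin d) → ℝ) (α C C₁ : ℝ) : Prop where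
  const_pos : 0 < C
  rate_pos : 0 < C₁
  bound : ∀ s : EuclideanSpace ℝ (Fin d),
    ‖fourierHat p s‖ ≤ C * Real.exp (-(C₁ * ∑ j, |s j| ^ α))

/-- `p` is lower-supersmooth of order `α` with associated constants `c` and `C₂`. -/
structure IsLowerSupersmooth {d : ℕ} (p : EuclideanSpace ℝ (Fin d) → ℝ) (α c C₂ : ℝ) : Prop where
  const_pos : 0 < c
  rate_pos : 0 < C₂
  bound : ∀ s : EuclideanSpace ℝ (Fin d),
    c * Real.exp (-(C₂ * ∑ j, |s j| ^ α)) ≤ ‖fourierHat p s‖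

/-- The sets `Θ ⊆ ℝ^d` on which the derivatives of a function given on `Θ` only make sense, and
on which a continuous function is determined by its values almost everywhere. All open sets and
all convex sets with nonempty interior qualify. -/
structure IsParameterSet {d : ℕ} (Θ : Set (EuclideanSpace ℝ (Fin d))) : Prop where
  nullMeasurableSet : NullMeasurableSet Θ volume
  uniqueDiffOn : UniqueDiffOn ℝ Θ
  volume_ne_zero : ∀ θ ∈ Θ, ∀ U ∈ 𝓝 θ, volume (U ∩ Θ) ≠ 0

/-- The class `𝒞^r(Θ)`: the derivatives on `Θ` up to order `r` exist and are continuous, bounded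
and integrable on `Θ`. -/
structure IsBoundedIntegrableCr {d : ℕ} (r : ℕ) (Θ : Set (EuclideanSpace ℝ (Fin d)))
    (h : EuclideanSpace ℝ (Fin d) → ℝ) : Prop where
  contDiffOn : ContDiffOn ℝ (r : ℕ∞) h Θ
  bounded : ∀ k ≤ r, ∃ M : ℝ, ∀ θ ∈ Θ, ‖iteratedFDerivWithin ℝ k h Θ θ‖ ≤ M
  integrable : ∀ k ≤ r, IntegrableOn (iteratedFDerivWithin ℝ k h Θ) Θ volume

/-- The density `p₀(x) = ∫_Θ f(x - θ) g(θ) dθ` of the observations. -/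
def mixtureDensity {d : ℕ} (Θ : Set (EuclideanSpace ℝ (Fin d)))
    (f g : EuclideanSpace ℝ (Fin d) → ℝ) (x : EuclideanSpace ℝ (Fin d)) : ℝ :=
  ∫ θ in Θ, f (x - θ) * g θ

/-- The cube `[-R, R]^d`. -/
def cube (d : ℕ) (R : ℝ) : Set (EuclideanSpace ℝ (Fin d)) :=
  {s | ∀ j, s j ∈ Set.Icc (-R) R}

/-- The Fourier deconvolution estimator
`ĝ_{n,R}(θ) = (n (2π)^d)⁻¹ ∑ⱼ ∫_{[-R,R]^d} cos(sᵀ(θ - xⱼ)) / f̂(s) ds` computed from the sample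
`x₁, …, xₙ`. It is used for symmetric `f` only, for which `f̂` is real-valued. -/
def deconvEstimator {d n : ℕ} (f : EuclideanSpace ℝ (Fin d) → ℝ) (R : ℝ)
    (x : Fin n → EuclideanSpace ℝ (Fin d)) (θ : EuclideanSpace ℝ (Fin d)) : ℝ :=
  1 / ((n : ℝ) * (2 * Real.pi) ^ d) *
    ∑ j, ∫ s in cube d R, Real.cos (inner ℝ s (θ - x j)) / (fourierHat f s).re

/-- The tensor `∇^i h(θ) = (∂^i h / ∂θ_{u₁} ⋯ ∂θ_{uᵢ} (θ))_u` of the partial derivatives of order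
`i` of a function `h` on `S`, as an element of `ℝ^(d^i)` with the Euclidean norm. -/
def nablaWithin {d : ℕ} (i : ℕ) (S : Set (EuclideanSpace ℝ (Fin d)))
    (h : EuclideanSpace ℝ (Fin d) → ℝ) (θ : EuclideanSpace ℝ (Fin d)) :
    EuclideanSpace ℝ (Fin i → Fin d) :=
  WithLp.toLp 2 fun u =>
    iteratedFDerivWithin ℝ i h S θ fun k => EuclideanSpace.single (u k) (1 : ℝ)

/-- The tensor of the partial derivatives of order `i` of a function on the whole of `ℝ^d`. -/
def nabla {d : ℕ} (i : ℕ) (h : EuclideanSpace ℝ (Fin d) → ℝ) (θ : EuclideanSpace ℝ (Fin d)) :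
    EuclideanSpace ℝ (Fin i → Fin d) :=
  WithLp.toLp 2 fun u =>
    iteratedFDeriv ℝ i h θ fun k => EuclideanSpace.single (u k) (1 : ℝ)

/-- The maximum norm `‖T‖_max` of the entries. -/
def maxNorm {ι : Type*} [Fintype ι] (T : EuclideanSpace ℝ ι) : ℝ :=
  ⨆ u, |T u|

/-- `X₁, …, Xₙ` are independent random vectors with common density `p`. -/
structure IsIIDSample {Ω : Type*} [MeasurableSpace Ω] {d n : ℕ} (P : Measure Ω)
    (X : Fin n → Ω → EuclideanSpace ℝ (Fin d)) (p : EuclideanSpace ℝ (Fin d) → ℝ) : Prop where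
  aemeasurable : ∀ j, AEMeasurable (X j) P
  indep : iIndepFun X P
  law : ∀ j, P.map (X j) = volume.withDensity fun x => ENNReal.ofReal (p x)

end

/-! Everything is expressed through `trigIntegral`. The estimator is an average of translates of the
real part of the trigonometric integral of `deconvWeight`, that is, of the inverse of `fourierHat f`
cut off to the cube. By Fourier inversion `g` agrees on `Θ` with `(2π)^(-d)` times the real part of
the trigonometric integral of `fourierHat g`. A partial derivative of order `i` inserts the factor
`partialMultiplier` in both integrals.

Bias: the transform of the mixture is `fourierHat f * fourierHat g`, so taking expectations cancels
`fourierHat f`, and the mean is the inversion integral of `∇^i g` restricted to the cube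
(`integral_nabla_deconvEstimator_apply`, `nablaWithin_apply_eq_trigIntegral`). The bias is therefore
an integral over the complement of the cube. Upper supersmoothness bounds it by one-dimensional
tails, and `integral_Ioi_pow_mul_exp_neg_rpow_le` shows that these are of order `R^(i+1-α₂) exp(-C₁
R^α₂)`.

Variance: on the cube lower supersmoothness gives `1/|f̂| ≤ c⁻¹ exp(C₂ d R^α₁)`, so each summand is
bounded by a constant times `R^(i+d) exp(C₂ d R^α₁)`. Independence turns the square of this bound
into the rate with `1/n`. -/

open scoped FourierTransform

/-! ### Trigonometric integrals and their derivatives -/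

section TrigonometricIntegral

variable {d : ℕ}

/-- The trigonometric integral `∫ exp(i sᵀy) h(s) ds`. -/
noncomputable def trigIntegral (h : EuclideanSpace ℝ (Fin d) → ℂ) (y : EuclideanSpace ℝ (Fin d)) :
    ℂ :=
  ∫ s, Complex.exp (Complex.I * ((inner ℝ s y : ℝ) : ℂ)) * h s

/-- The bilinear form that turns `VectorFourier.fourierIntegral` into `trigIntegral`. -/
noncomputable def trigForm (d : ℕ) :
    EuclideanSpace ℝ (Fin d) →L[ℝ] EuclideanSpace ℝ (Fin d) →L[ℝ] ℝ :=
  (-(2 * Real.pi)⁻¹) • innerSL ℝ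

lemma trigForm_apply (s y : EuclideanSpace ℝ (Fin d)) :
    trigForm d s y = -((2 * Real.pi)⁻¹ * inner ℝ s y) := by
  simp only [trigForm, smul_apply, smul_eq_mul, neg_mul]
  rfl

lemma fourierChar_neg_trigForm (s y : EuclideanSpace ℝ (Fin d)) :
    ((𝐞 (-(trigForm d s y)) : Circle) : ℂ) = Complex.exp (Complex.I * ((inner ℝ s y : ℝ) : ℂ)) := by
  rw [Real.fourierChar_apply, trigForm_apply, neg_neg]
  congr 1
  have : (Real.pi : ℂ) ≠ 0 := by exact_mod_cast Real.pi_ne_zero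
  push_cast
  field_simp

/-- Transfers smoothness and the derivative formulas, both under moment conditions on `h`, from
`VectorFourier.fourierIntegral`. -/
lemma trigIntegral_eq_fourierIntegral (h : EuclideanSpace ℝ (Fin d) → ℂ) :
    trigIntegral h = VectorFourier.fourierIntegral 𝐞 volume (trigForm d).toLinearMap₁₂ h := by
  ext y
  simp only [trigIntegral, VectorFourier.fourierIntegral]
  congr 1
  ext s
  rw [Circle.smul_def, ContinuousLinearMap.toLinearMap₁₂_apply_apply_apply, smul_eq_mul]
  erw [fourierChar_neg_trigForm]

lemma norm_exp_I_mul_ofReal (t : ℝ) : ‖Complex.exp (Complex.I * (t : ℂ))‖ = 1 := by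
  rw [mul_comm, Complex.norm_exp_ofReal_mul_I]

lemma integrable_exp_inner_mul {h : EuclideanSpace ℝ (Fin d) → ℂ} (hh : Integrable h)
    (y : EuclideanSpace ℝ (Fin d)) :
    Integrable fun s => Complex.exp (Complex.I * ((inner ℝ s y : ℝ) : ℂ)) * h s := by
  refine hh.mono (AEStronglyMeasurable.mul (Continuous.aestronglyMeasurable (by fun_prop)) hh.1)
    (Filter.Eventually.of_forall fun s => ?_)
  rw [norm_mul, norm_exp_I_mul_ofReal, one_mul]

lemma norm_trigIntegral_le (h : EuclideanSpace ℝ (Fin d) → ℂ) (y : EuclideanSpace ℝ (Fin d)) :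
    ‖trigIntegral h y‖ ≤ ∫ s, ‖h s‖ := by
  refine (norm_integral_le_integral_norm _).trans (le_of_eq ?_)
  simp_rw [norm_mul, norm_exp_I_mul_ofReal, one_mul]

lemma continuous_trigIntegral {h : EuclideanSpace ℝ (Fin d) → ℂ} (hh : Integrable h) :
    Continuous (trigIntegral h) := by
  refine continuous_of_dominated (bound := fun s => ‖h s‖) (fun y => ?_) (fun y => ?_) hh.norm ?_
  · exact (integrable_exp_inner_mul hh y).1
  · refine Filter.Eventually.of_forall fun s => ?_
    rw [norm_mul, norm_exp_I_mul_ofReal, one_mul]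
  · refine Filter.Eventually.of_forall fun s => ?_
    fun_prop

lemma contDiff_trigIntegral {h : EuclideanSpace ℝ (Fin d) → ℂ} {N : ℕ}
    (hh : ∀ n ≤ N, Integrable fun s => ‖s‖ ^ n * ‖h s‖) :
    ContDiff ℝ (N : ℕ∞) (trigIntegral h) := by
  rw [trigIntegral_eq_fourierIntegral]
  exact VectorFourier.contDiff_fourierIntegral (trigForm d) fun n hn => hh n (by exact_mod_cast hn)

lemma integrable_prod_inner_mul {h : EuclideanSpace ℝ (Fin d) → ℂ} {n : ℕ}
    (hh : Integrable fun s => ‖s‖ ^ n * ‖h s‖) (hm : AEStronglyMeasurable h)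
    (v : Fin n → EuclideanSpace ℝ (Fin d)) :
    Integrable fun s => Complex.I ^ n * ((∏ k, inner ℝ s (v k) : ℝ) : ℂ) * h s := by
  refine (hh.const_mul (∏ k, ‖v k‖)).mono'
    (AEStronglyMeasurable.mul (Continuous.aestronglyMeasurable (by fun_prop)) hm)
    (Filter.Eventually.of_forall fun s => ?_)
  rw [norm_mul, norm_mul, norm_pow, Complex.norm_I, one_pow, one_mul, Complex.norm_real, norm_prod,
    ← mul_assoc]
  gcongr
  calc ∏ k, ‖(inner ℝ s (v k) : ℝ)‖ ≤ ∏ k, ‖v k‖ * ‖s‖ := by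
        gcongr with k
        rw [mul_comm]
        exact norm_inner_le_norm _ _
    _ = _ := by rw [Finset.prod_mul_distrib, Finset.prod_const, Finset.card_univ, Fintype.card_fin]

lemma iteratedFDeriv_trigIntegral {h : EuclideanSpace ℝ (Fin d) → ℂ} {N : ℕ}
    (hh : ∀ n ≤ N, Integrable fun s => ‖s‖ ^ n * ‖h s‖) (hm : AEStronglyMeasurable h)
    {n : ℕ} (hn : n ≤ N) (y : EuclideanSpace ℝ (Fin d)) (v : Fin n → EuclideanSpace ℝ (Fin d)) :
    iteratedFDeriv ℝ n (trigIntegral h) y v =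
      trigIntegral (fun s => Complex.I ^ n * ((∏ k, inner ℝ s (v k) : ℝ) : ℂ) * h s) y := by
  rw [trigIntegral_eq_fourierIntegral, VectorFourier.iteratedFDeriv_fourierIntegral (N := N)
    (trigForm d) (fun n hn => hh n (by exact_mod_cast hn)) hm (by exact_mod_cast hn)]
  rw [Real.fourierIntegral_continuousMultilinearMap_apply']
  · rw [trigIntegral_eq_fourierIntegral]
    congr 1
    ext s
    rw [VectorFourier.fourierPowSMulRight_apply]
    simp only [trigForm_apply, smul_eq_mul, Complex.real_smul]
    rw [← mul_assoc]
    congr 1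
    -- The `n` factors `-(2π)⁻¹` from `trigForm` cancel `(-2πi)^n` down to `i^n`.
    have : ∀ k : Fin n, -((2 * Real.pi)⁻¹ * inner ℝ s (v k)) =
        (-(2 * Real.pi)⁻¹) * inner ℝ s (v k) := fun k => by ring
    simp_rw [this]
    rw [Finset.prod_mul_distrib, Finset.prod_const, Finset.card_univ, Fintype.card_fin]
    push_cast
    rw [← mul_assoc, ← mul_pow]
    congr 2
    have : (Real.pi : ℂ) ≠ 0 := by exact_mod_cast Real.pi_ne_zero
    field_simp
  · exact VectorFourier.integrable_fourierPowSMulRight (trigForm d) (hh n hn) hm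

lemma iteratedFDeriv_re_trigIntegral {h : EuclideanSpace ℝ (Fin d) → ℂ} {N : ℕ}
    (hh : ∀ n ≤ N, Integrable fun s => ‖s‖ ^ n * ‖h s‖) (hm : AEStronglyMeasurable h)
    {n : ℕ} (hn : n ≤ N) (y : EuclideanSpace ℝ (Fin d)) (v : Fin n → EuclideanSpace ℝ (Fin d)) :
    iteratedFDeriv ℝ n (fun y => (trigIntegral h y).re) y v =
      (trigIntegral (fun s => Complex.I ^ n * ((∏ k, inner ℝ s (v k) : ℝ) : ℂ) * h s) y).re := by
  rw [← iteratedFDeriv_trigIntegral hh hm hn]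
  have h1 := (contDiff_trigIntegral hh).contDiffAt (x := y)
  have := Complex.reCLM.iteratedFDeriv_comp_left h1 (i := n) (by exact_mod_cast hn)
  change iteratedFDeriv ℝ n (Complex.reCLM ∘ trigIntegral h) y v = _
  rw [this]
  rfl

end TrigonometricIntegral

/-! ### Fourier inversion almost everywhere -/

section FourierInversion

variable {d : ℕ}

/-- With no continuity of `p` assumed, equality is tested against smooth compactly supported
functions. These are Schwartz, so inversion holds for them, and the self-adjointness of `𝓕` moves
both transforms onto `p`. -/
lemma MeasureTheory.Integrable.fourierInv_fourier_ae_eq {V : Type*} [NormedAddCommGroup V]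
    [InnerProductSpace ℝ V] [FiniteDimensional ℝ V] [MeasurableSpace V] [BorelSpace V]
    {p : V → ℂ} (hp : Integrable p) (hp' : Integrable (𝓕 p)) : p =ᵐ[volume] 𝓕⁻ (𝓕 p) := by
  have hcont : Continuous (𝓕⁻ (𝓕 p)) := by
    have : 𝓕⁻ (𝓕 p) = fun y => 𝓕 (𝓕 p) (-y) := by
      ext y; exact Real.fourierInv_eq_fourier_neg _ _
    rw [this]
    exact (VectorFourier.fourierIntegral_continuous Real.continuous_fourierChar
      (by exact continuous_inner) hp').comp continuous_neg
  refine ae_eq_of_integral_contDiff_smul_eq hp.locallyIntegrable hcont.locallyIntegrable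
    fun φ hφ hφc => ?_
  have hψc : HasCompactSupport fun x => (φ x : ℂ) := hφc.comp_left (g := fun t : ℝ => (t : ℂ)) rfl
  have hψ : ContDiff ℝ (⊤ : ℕ∞) fun x => (φ x : ℂ) := Complex.ofRealCLM.contDiff.comp hφ
  set ψ : SchwartzMap V ℂ := hψc.toSchwartzMap hψ with hψdef
  have hψφ : ∀ x, ψ x = (φ x : ℂ) := fun x => rfl
  have hψ' : Integrable (𝓕⁻ (ψ : V → ℂ)) := by
    rw [← SchwartzMap.fourierInv_coe]; exact SchwartzMap.integrable _
  have e1 : 𝓕 (𝓕⁻ (ψ : V → ℂ)) = ψ := by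
    refine ψ.continuous.fourier_fourierInv_eq ψ.integrable ?_
    rw [← SchwartzMap.fourier_coe]; exact SchwartzMap.integrable _
  have key : ∀ a b : V → ℂ, Integrable a → Integrable b →
      ∫ x, 𝓕 a x * b x = ∫ x, a x * 𝓕 b x := fun a b ha hb => by
    have := VectorFourier.integral_fourierIntegral_smul_eq_flip (μ := volume) (ν := volume)
      (L := innerₗ V) Real.continuous_fourierChar continuous_inner ha hb
    rw [flip_innerₗ] at this
    exact this
  simp only [Complex.real_smul, ← hψφ]
  calc ∫ x, ψ x * p x = ∫ x, 𝓕 (𝓕⁻ (ψ : V → ℂ)) x * p x := by rw [e1]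
    _ = ∫ x, 𝓕⁻ (ψ : V → ℂ) x * 𝓕 p x := key _ _ hψ' hp
    _ = ∫ x, 𝓕 (ψ : V → ℂ) (-x) * 𝓕 p x := by simp_rw [Real.fourierInv_eq_fourier_neg]
    _ = ∫ x, 𝓕 (ψ : V → ℂ) x * 𝓕 p (-x) := by
        rw [← integral_neg_eq_self]; simp_rw [neg_neg]
    _ = ∫ x, ψ x * 𝓕 (fun y => 𝓕 p (-y)) x := key _ _ ψ.integrable hp'.comp_neg
    _ = _ := by rw [Real.fourierInv_eq_fourier_comp_neg]

lemma fourierHat_eq_fourier (p : EuclideanSpace ℝ (Fin d) → ℝ) (s : EuclideanSpace ℝ (Fin d)) :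
    fourierHat p ((2 * Real.pi) • s) = 𝓕 (fun x => (p x : ℂ)) s := by
  rw [Real.fourier_eq']
  simp only [fourierHat, smul_eq_mul]
  congr 1
  ext x
  rw [inner_smul_left, real_inner_comm]
  congr 2
  push_cast
  simp
  ring

lemma fourierHat_eq_trigIntegral (p : EuclideanSpace ℝ (Fin d) → ℝ)
    (s : EuclideanSpace ℝ (Fin d)) : fourierHat p s = trigIntegral (fun x => (p x : ℂ)) (-s) := by
  simp only [fourierHat, trigIntegral]
  congr 1
  ext x
  rw [inner_neg_right, real_inner_comm]
  push_cast
  ring_nf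

lemma continuous_fourierHat {p : EuclideanSpace ℝ (Fin d) → ℝ} (hp : Integrable p) :
    Continuous (fourierHat p) := by
  have : fourierHat p = fun s => trigIntegral (fun x => (p x : ℂ)) (-s) := by
    ext s; exact fourierHat_eq_trigIntegral p s
  rw [this]
  exact (continuous_trigIntegral hp.ofReal).comp continuous_neg

lemma ae_eq_trigIntegral_fourierHat {p : EuclideanSpace ℝ (Fin d) → ℝ} (hp : Integrable p)
    (hp' : Integrable (fourierHat p)) :
    (fun x => (p x : ℂ)) =ᵐ[volume]
      fun x => ((((2 * Real.pi) ^ d)⁻¹ : ℝ) : ℂ) * trigIntegral (fourierHat p) x := by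
  have hpi : (2 * Real.pi) ≠ 0 := by positivity
  have h0 : Integrable fun x => (p x : ℂ) := hp.ofReal
  have h1 : 𝓕 (fun x => (p x : ℂ)) = fun s => fourierHat p ((2 * Real.pi) • s) := by
    ext s; rw [fourierHat_eq_fourier]
  have h2 : Integrable (𝓕 (fun x => (p x : ℂ))) := by
    rw [h1]; exact hp'.comp_smul hpi
  refine (h0.fourierInv_fourier_ae_eq h2).trans (Filter.Eventually.of_forall fun x => ?_)
  -- The substitution `s ↦ 2π s` between the two normalizations produces the factor `(2π)^(-d)`.
  have h3 := Measure.integral_comp_smul (volume : Measure (EuclideanSpace ℝ (Fin d)))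
    (fun s => Complex.exp (Complex.I * ((inner ℝ s x : ℝ) : ℂ)) * fourierHat p s) (2 * Real.pi)
  rw [finrank_euclideanSpace_fin, abs_of_pos (by positivity)] at h3
  show _ = _ * trigIntegral (fourierHat p) x
  rw [trigIntegral, ← Complex.real_smul, ← h3, h1, Real.fourierInv_eq']
  congr 1
  ext s
  simp only [smul_eq_mul, inner_smul_left]
  congr 2
  push_cast
  simp
  ring

end FourierInversion

/-! ### One-dimensional tail bounds -/

section TailIntegrals

lemma integrableOn_pow_mul_exp_neg_rpow {α C : ℝ} (hα : 0 < α) (hC : 0 < C) (i : ℕ) :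
    IntegrableOn (fun t : ℝ => t ^ i * Real.exp (-(C * t ^ α))) (Set.Ioi 0) := by
  have := integrableOn_rpow_mul_exp_neg_mul_rpow (s := i)
    (by linarith [(Nat.cast_nonneg i : (0 : ℝ) ≤ i)]) hα hC
  simpa only [Real.rpow_natCast, neg_mul] using this

lemma integrable_comp_abs_of_integrableOn_Ioi {f : ℝ → ℝ} (hf : IntegrableOn f (Set.Ioi 0)) :
    Integrable fun t => f |t| := by
  have h1 : IntegrableOn (fun t => f |t|) (Set.Ioi 0) :=
    hf.congr_fun (fun t ht => by rw [abs_of_pos ht]) measurableSet_Ioi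
  have h2 : IntegrableOn (fun t => f |t|) (Set.Iic 0) := by
    rw [← Measure.map_neg_eq_self (volume : Measure ℝ)]
    let m : MeasurableEmbedding fun x : ℝ => -x := (Homeomorph.neg ℝ).measurableEmbedding
    rw [m.integrableOn_map_iff]
    simp_rw [Function.comp_def, abs_neg, Set.neg_preimage, Set.neg_Iic, neg_zero]
    exact (integrableOn_Ici_iff_integrableOn_Ioi (μ := volume)).mpr h1
  rw [← integrableOn_univ, ← Set.Iic_union_Ioi (a := (0 : ℝ))]
  exact h2.union h1

lemma integrable_abs_pow_mul_exp_neg_rpow {α C : ℝ} (hα : 0 < α) (hC : 0 < C) (i : ℕ) :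
    Integrable fun t : ℝ => |t| ^ i * Real.exp (-(C * |t| ^ α)) :=
  integrable_comp_abs_of_integrableOn_Ioi (integrableOn_pow_mul_exp_neg_rpow hα hC i)

/-- With `q = i + 1 - α`, the function `F = -t^q exp(-C t^α)` has derivative `(C α t^α - q) t^(q-1)
exp(-C t^α)`. The condition on `R` makes `q` at most half of `C α t^α`, so `F'` dominates `C α / 2`
times the integrand, and `F` vanishes at infinity. -/
lemma integral_Ioi_pow_mul_exp_neg_rpow_le {α C R : ℝ} (hα : 0 < α) (hC : 0 < C) (i : ℕ)
    (hR0 : 0 < R) (hR : 2 * (i + 1 + α) ≤ C * α * R ^ α) :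
    ∫ t in Set.Ioi R, t ^ i * Real.exp (-(C * t ^ α)) ≤
      2 / (C * α) * (R ^ ((i : ℝ) + 1 - α) * Real.exp (-(C * R ^ α))) := by
  set q : ℝ := (i : ℝ) + 1 - α with hq
  set F : ℝ → ℝ := fun t => -(t ^ q * Real.exp (-(C * t ^ α))) with hF
  set F' : ℝ → ℝ := fun t => (C * α * t ^ α - q) * (t ^ (q - 1) * Real.exp (-(C * t ^ α)))
  have hderiv : ∀ t ∈ Set.Ici R, HasDerivAt F (F' t) t := by
    intro t ht
    have ht0 : 0 < t := hR0.trans_le ht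
    have h1 := Real.hasDerivAt_rpow_const (p := q) (Or.inl ht0.ne')
    have h2 := (((Real.hasDerivAt_rpow_const (p := α) (Or.inl ht0.ne')).const_mul C).neg).exp
    convert! (h1.mul h2).neg using 1
    have e1 : t ^ q = t ^ (q - 1) * t := by
      rw [← Real.rpow_add_one ht0.ne', sub_add_cancel]
    have e2 : t ^ α = t ^ (α - 1) * t := by
      rw [← Real.rpow_add_one ht0.ne', sub_add_cancel]
    simp only [F', Pi.neg_apply]
    rw [e1, e2]
    ring
  have hlow : ∀ t ∈ Set.Ioi R,
      C * α / 2 * (t ^ i * Real.exp (-(C * t ^ α))) ≤ F' t := by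
    intro t ht
    have ht0 : 0 < t := hR0.trans ht
    have e : t ^ i = t ^ α * t ^ (q - 1) := by
      rw [← Real.rpow_add ht0, ← Real.rpow_natCast]
      congr 1
      rw [hq]; ring
    have h3 : R ^ α ≤ t ^ α := Real.rpow_le_rpow hR0.le (le_of_lt ht) hα.le
    have h4 : C * α * R ^ α ≤ C * α * t ^ α := by gcongr
    have h5 : C * α / 2 * t ^ α ≤ C * α * t ^ α - q := by
      rw [hq]; linarith [(Nat.cast_nonneg i : (0 : ℝ) ≤ i)]
    calc _ = (C * α / 2 * t ^ α) * (t ^ (q - 1) * Real.exp (-(C * t ^ α))) := by rw [e]; ring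
      _ ≤ _ := by
        apply mul_le_mul_of_nonneg_right h5
        positivity
  have hpos : ∀ t ∈ Set.Ioi R, 0 ≤ F' t := fun t ht => by
    have ht0 : 0 < t := hR0.trans ht
    refine le_trans ?_ (hlow t ht)
    positivity
  have hlim : Filter.Tendsto F Filter.atTop (𝓝 0) := by
    have h1 := (tendsto_rpow_mul_exp_neg_mul_atTop_nhds_zero (q / α) C hC).comp
      (tendsto_rpow_atTop hα)
    have h2 := h1.neg
    rw [neg_zero] at h2
    refine h2.congr' ?_
    filter_upwards [Filter.eventually_gt_atTop 0] with t ht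
    simp only [Function.comp, hF]
    rw [← Real.rpow_mul ht.le, mul_div_cancel₀ _ hα.ne', neg_mul]
  have hint := integrableOn_Ioi_deriv_of_nonneg' hderiv hpos hlim
  have hval := integral_Ioi_of_hasDerivAt_of_nonneg' hderiv hpos hlim
  have hmono : ∫ t in Set.Ioi R, C * α / 2 * (t ^ i * Real.exp (-(C * t ^ α))) ≤
      ∫ t in Set.Ioi R, F' t := by
    refine setIntegral_mono_on ?_ hint measurableSet_Ioi hlow
    exact ((integrableOn_pow_mul_exp_neg_rpow hα hC i).mono_set
      (Set.Ioi_subset_Ioi hR0.le)).const_mul _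
  rw [integral_const_mul, hval] at hmono
  simp only [hF, zero_sub, neg_neg] at hmono
  rw [div_mul_eq_mul_div, le_div_iff₀ (by positivity)]
  linarith

lemma integral_abs_gt_pow_mul_exp_neg_rpow_le {α C R : ℝ} (hα : 0 < α) (hC : 0 < C) (i : ℕ)
    (hR0 : 0 < R) (hR : 2 * (i + 1 + α) ≤ C * α * R ^ α) :
    ∫ t : ℝ, {x : ℝ | R < |x|}.indicator (fun t => |t| ^ i * Real.exp (-(C * |t| ^ α))) t ≤
      4 / (C * α) * (R ^ ((i : ℝ) + 1 - α) * Real.exp (-(C * R ^ α))) := by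
  have h1 : ∀ t : ℝ, {x : ℝ | R < |x|}.indicator (fun t => |t| ^ i * Real.exp (-(C * |t| ^ α))) t =
      (Set.Ioi R).indicator (fun t => t ^ i * Real.exp (-(C * t ^ α))) |t| := fun t => by
    by_cases h : R < |t|
    · rw [Set.indicator_of_mem (by exact h), Set.indicator_of_mem (by exact h)]
    · rw [Set.indicator_of_notMem (by exact h), Set.indicator_of_notMem (by exact h)]
  simp_rw [h1]
  rw [integral_comp_abs (f := (Set.Ioi R).indicator fun t => t ^ i * Real.exp (-(C * t ^ α))),
    setIntegral_indicator measurableSet_Ioi, Set.Ioi_inter_Ioi, sup_of_le_right hR0.le]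
  have := integral_Ioi_pow_mul_exp_neg_rpow_le hα hC i hR0 hR
  calc _ ≤ 2 * _ := mul_le_mul_of_nonneg_left this zero_le_two
    _ = _ := by ring

end TailIntegrals

/-! ### Product integrals and the complement of the cube -/

section ProductIntegrals

variable {d : ℕ}

lemma integrable_euclidean_prod {φ : Fin d → ℝ → ℝ} (hφ : ∀ j, Integrable (φ j)) :
    Integrable fun s : EuclideanSpace ℝ (Fin d) => ∏ j, φ j (s j) :=
  (PiLp.volume_preserving_ofLp (Fin d)).integrable_comp_of_integrable
    (Integrable.fintype_prod hφ)

lemma integral_euclidean_prod (φ : Fin d → ℝ → ℝ) :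
    ∫ s : EuclideanSpace ℝ (Fin d), ∏ j, φ j (s j) = ∏ j, ∫ t, φ j t := by
  rw [← integral_fintype_prod_volume_eq_prod]
  exact (PiLp.volume_preserving_ofLp (Fin d)).integral_comp
    (MeasurableEquiv.measurableEmbedding (MeasurableEquiv.toLp 2 (Fin d → ℝ)).symm)
    fun x => ∏ j, φ j (x j)

lemma one_add_sum_le_prod_one_add {ι : Type*} (S : Finset ι) {a : ι → ℝ} (ha : ∀ j, 0 ≤ a j) :
    1 + ∑ j ∈ S, a j ≤ ∏ j ∈ S, (1 + a j) := by
  classical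
  induction S using Finset.induction_on with
  | empty => simp
  | insert j S hj ih =>
    rw [Finset.sum_insert hj, Finset.prod_insert hj]
    nlinarith [ha j, Finset.sum_nonneg (s := S) fun k _ => ha k]

/-- A product majorant of the norm, so that moments of product weights reduce to one-dimensional
integrals. -/
lemma norm_le_prod_one_add_abs (s : EuclideanSpace ℝ (Fin d)) : ‖s‖ ≤ ∏ j, (1 + |s j|) := by
  have h1 : ‖s‖ ≤ ∑ j, |s j| := by
    rw [EuclideanSpace.norm_eq, Real.sqrt_le_left (Finset.sum_nonneg fun j _ => abs_nonneg _)]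
    exact Finset.sum_sq_le_sq_sum_of_nonneg fun j _ => abs_nonneg _
  linarith [one_add_sum_le_prod_one_add Finset.univ fun j => abs_nonneg (s j)]

lemma integrable_one_add_abs_pow_mul_exp_neg_rpow {α C : ℝ} (hα : 0 < α) (hC : 0 < C) (n : ℕ) :
    Integrable fun t : ℝ => (1 + |t|) ^ n * Real.exp (-(C * |t| ^ α)) := by
  simp_rw [add_pow, one_pow, one_mul, Finset.sum_mul]
  refine integrable_finsetSum _ fun m _ => ?_
  refine ((integrable_abs_pow_mul_exp_neg_rpow hα hC (n - m)).const_mul (n.choose m)).congr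
    (Filter.Eventually.of_forall fun t => ?_)
  simp only
  ring

lemma exp_neg_mul_sum_rpow {α C : ℝ} (s : EuclideanSpace ℝ (Fin d)) :
    Real.exp (-(C * ∑ j, |s j| ^ α)) = ∏ j, Real.exp (-(C * |s j| ^ α)) := by
  rw [← Real.exp_sum, Finset.sum_neg_distrib, Finset.mul_sum]

lemma integrable_norm_pow_mul_exp_neg {α C : ℝ} (hα : 0 < α) (hC : 0 < C) (n : ℕ) :
    Integrable fun s : EuclideanSpace ℝ (Fin d) => ‖s‖ ^ n * Real.exp (-(C * ∑ j, |s j| ^ α)) := by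
  refine (integrable_euclidean_prod (d := d)
    fun _ => integrable_one_add_abs_pow_mul_exp_neg_rpow hα hC n).mono'
    (Measurable.aestronglyMeasurable (by fun_prop)) (Filter.Eventually.of_forall fun s => ?_)
  rw [Real.norm_of_nonneg (by positivity), Finset.prod_mul_distrib, Finset.prod_pow,
    exp_neg_mul_sum_rpow]
  gcongr
  exact norm_le_prod_one_add_abs s

lemma measurableSet_cube (d : ℕ) (R : ℝ) : MeasurableSet (cube d R) := by
  have : cube d R = ⋂ j, (fun s : EuclideanSpace ℝ (Fin d) => s j) ⁻¹' Set.Icc (-R) R := by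
    ext s; simp [cube]
  rw [this]
  exact MeasurableSet.iInter fun j => (by fun_prop : Measurable
    fun s : EuclideanSpace ℝ (Fin d) => s j) measurableSet_Icc

lemma volume_cube (d : ℕ) {R : ℝ} (hR : 0 ≤ R) :
    volume (cube d R) = ENNReal.ofReal ((2 * R) ^ d) := by
  have h1 : cube d R = (fun s : EuclideanSpace ℝ (Fin d) => WithLp.ofLp s) ⁻¹'
      (Set.univ.pi fun _ => Set.Icc (-R) R) := by
    ext s
    simp only [cube, Set.mem_ofPred_eq, Set.mem_preimage, Set.mem_univ_pi]
  rw [h1, (PiLp.volume_preserving_ofLp (Fin d)).measure_preimage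
    (MeasurableSet.univ_pi fun _ => measurableSet_Icc).nullMeasurableSet, volume_pi_pi]
  simp only [Real.volume_Icc, Finset.prod_const, Finset.card_univ, Fintype.card_fin]
  rw [← ENNReal.ofReal_pow (by linarith)]
  congr 2
  ring

/-- Outside the cube `[-R, R]^d` a monomial weight is dominated by the sum over the coordinates of
products of one-dimensional functions, one of which is a tail. -/
lemma prod_abs_mul_exp_le_sum {α C R : ℝ} {i : ℕ} (u : Fin i → Fin d)
    (s : EuclideanSpace ℝ (Fin d)) (hs : s ∉ cube d R) :
    (∏ k, |s (u k)|) * Real.exp (-(C * ∑ j, |s j| ^ α)) ≤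
      ∑ l, ∏ j, (if j = l then
        {x : ℝ | R < |x|}.indicator (fun t => |t| ^ i * Real.exp (-(C * |t| ^ α)))
        else fun t => Real.exp (-(C * |t| ^ α))) (s j) := by
  obtain ⟨j₀, hj₀⟩ : ∃ j, R < |s j| := by
    by_contra! h
    exact hs fun j => abs_le.mp (h j)
  -- The coordinate of largest modulus exceeds `R` and bounds every factor of the monomial, so it
  -- alone can carry the power `i`.
  obtain ⟨l, -, hl⟩ := Finset.exists_max_image Finset.univ (fun j => |s j|) ⟨j₀, Finset.mem_univ _⟩
  have hRl : R < |s l| := hj₀.trans_le (hl j₀ (Finset.mem_univ _))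
  have hterm : (∏ k, |s (u k)|) * Real.exp (-(C * ∑ j, |s j| ^ α)) ≤
      ∏ j, (if j = l then
        {x : ℝ | R < |x|}.indicator (fun t => |t| ^ i * Real.exp (-(C * |t| ^ α)))
        else fun t => Real.exp (-(C * |t| ^ α))) (s j) := by
    have e : ∀ j, (if j = l then
        {x : ℝ | R < |x|}.indicator (fun t => |t| ^ i * Real.exp (-(C * |t| ^ α)))
        else fun t => Real.exp (-(C * |t| ^ α))) (s j) =
        (if j = l then |s l| ^ i else 1) * Real.exp (-(C * |s j| ^ α)) := fun j => by
      by_cases h : j = l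
      · subst h
        rw [if_pos rfl, if_pos rfl, Set.indicator_of_mem (by exact hRl)]
      · rw [if_neg h, if_neg h, one_mul]
    simp_rw [e]
    rw [Finset.prod_mul_distrib, Finset.prod_ite_eq' Finset.univ l fun _ => |s l| ^ i,
      if_pos (Finset.mem_univ _), exp_neg_mul_sum_rpow]
    gcongr
    calc ∏ k, |s (u k)| ≤ ∏ _k : Fin i, |s l| := by
          exact Finset.prod_le_prod (fun k _ => abs_nonneg _) fun k _ => hl _ (Finset.mem_univ _)
      _ = _ := by simp
  refine hterm.trans (Finset.single_le_sum (f := fun l => ∏ j, (if j = l then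
        {x : ℝ | R < |x|}.indicator (fun t => |t| ^ i * Real.exp (-(C * |t| ^ α)))
        else fun t => Real.exp (-(C * |t| ^ α))) (s j)) (fun m _ => ?_) (Finset.mem_univ l))
  refine Finset.prod_nonneg fun j _ => ?_
  split_ifs
  · exact Set.indicator_nonneg (fun t _ => by positivity) _
  · positivity

lemma integrable_sum_prod_ite {T E : ℝ → ℝ} (hT : Integrable T) (hE : Integrable E) :
    Integrable fun s : EuclideanSpace ℝ (Fin d) =>
      ∑ l, ∏ j, (if j = l then T else E) (s j) := by
  refine integrable_finsetSum _ fun l _ =>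
    integrable_euclidean_prod (φ := fun j => if j = l then T else E) fun j => ?_
  split_ifs <;> assumption

/-- For `d = 0` the sum is empty and the factor `d` makes the truncated exponent `d - 1` harmless.
-/
lemma integral_sum_prod_ite {T E : ℝ → ℝ} (hT : Integrable T) (hE : Integrable E) :
    ∫ s : EuclideanSpace ℝ (Fin d), ∑ l, ∏ j, (if j = l then T else E) (s j) =
      d * ((∫ t, T t) * (∫ t, E t) ^ (d - 1)) := by
  have hl : ∀ l : Fin d, ∫ s : EuclideanSpace ℝ (Fin d), ∏ j, (if j = l then T else E) (s j) =
      (∫ t, T t) * (∫ t, E t) ^ (d - 1) := fun l => by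
    have h1 : ∀ j, ∫ t, (if j = l then T else E) t = if j = l then ∫ t, T t else ∫ t, E t :=
      fun j => by split_ifs <;> rfl
    rw [integral_euclidean_prod (fun j => if j = l then T else E),
      Finset.prod_congr rfl fun j _ => h1 j, Finset.prod_ite]
    simp [Finset.filter_eq', Finset.filter_ne']
  rw [integral_finsetSum _ fun l _ => integrable_euclidean_prod
    (φ := fun j => if j = l then T else E) fun j => by split_ifs <;> assumption]
  simp_rw [hl]
  simp

lemma integral_cube_compl_prod_abs_mul_exp_le {α C R : ℝ} (hα : 0 < α) (hC : 0 < C) {i : ℕ}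
    (u : Fin i → Fin d) (hR0 : 0 < R) (hR : 2 * (i + 1 + α) ≤ C * α * R ^ α) :
    ∫ s in (cube d R)ᶜ, (∏ k, |s (u k)|) * Real.exp (-(C * ∑ j, |s j| ^ α)) ≤
      d * ((4 / (C * α) * (R ^ ((i : ℝ) + 1 - α) * Real.exp (-(C * R ^ α)))) *
        (∫ t : ℝ, Real.exp (-(C * |t| ^ α))) ^ (d - 1)) := by
  have hEi : Integrable fun t : ℝ => Real.exp (-(C * |t| ^ α)) := by
    simpa using integrable_abs_pow_mul_exp_neg_rpow hα hC 0
  have hTi : Integrable ({x : ℝ | R < |x|}.indicator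
      (fun t => |t| ^ i * Real.exp (-(C * |t| ^ α)))) :=
    (integrable_abs_pow_mul_exp_neg_rpow hα hC i).indicator
      (measurableSet_lt measurable_const (by fun_prop))
  have hTE := integral_abs_gt_pow_mul_exp_neg_rpow_le hα hC i hR0 hR
  have hdom := fun s hs => prod_abs_mul_exp_le_sum (α := α) (C := C) (R := R) u s hs
  have hEn : ∀ t : ℝ, 0 ≤ Real.exp (-(C * |t| ^ α)) := fun t => (Real.exp_pos _).le
  have hTn : ∀ t, 0 ≤ {x : ℝ | R < |x|}.indicator
      (fun t => |t| ^ i * Real.exp (-(C * |t| ^ α))) t :=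
    fun t => Set.indicator_nonneg (fun t _ => by positivity) _
  generalize {x : ℝ | R < |x|}.indicator (fun t => |t| ^ i * Real.exp (-(C * |t| ^ α))) = T at *
  have hEi' : 0 ≤ ∫ t : ℝ, Real.exp (-(C * |t| ^ α)) := integral_nonneg hEn
  have hsum := integrable_sum_prod_ite (d := d) hTi hEi
  calc _ ≤ ∫ s in (cube d R)ᶜ, ∑ l, ∏ j,
          (if j = l then T else fun t => Real.exp (-(C * |t| ^ α))) (s j) := by
        refine integral_mono_of_nonneg (Filter.Eventually.of_forall fun s => ?_)
          hsum.integrableOn ?_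
        · exact mul_nonneg (Finset.prod_nonneg fun k _ => abs_nonneg _) (Real.exp_pos _).le
        · exact (ae_restrict_mem (measurableSet_cube d R).compl).mono hdom
    -- The majorant is nonnegative, so the domain may grow to the whole space, where its terms
    -- factorize.
    _ ≤ ∫ s : EuclideanSpace ℝ (Fin d), ∑ l, ∏ j,
          (if j = l then T else fun t => Real.exp (-(C * |t| ^ α))) (s j) := by
        refine setIntegral_le_integral hsum (Filter.Eventually.of_forall fun s => ?_)
        refine Finset.sum_nonneg fun l _ => Finset.prod_nonneg fun j _ => ?_
        split_ifs
        exacts [hTn _, hEn _]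
    _ = d * ((∫ t, T t) * (∫ t : ℝ, Real.exp (-(C * |t| ^ α))) ^ (d - 1)) :=
        integral_sum_prod_ite hTi hEi
    _ ≤ _ := by gcongr

end ProductIntegrals

/-! ### Transforms of the densities and expectations -/

section Densities

variable {d : ℕ}

/-- The substitution `x ↦ -x` identifies the transform with its conjugate. -/
lemma fourierHat_eq_re_of_even {f : EuclideanSpace ℝ (Fin d) → ℝ} (hf : ∀ x, f (-x) = f x)
    (s : EuclideanSpace ℝ (Fin d)) : fourierHat f s = ((fourierHat f s).re : ℂ) := by
  have h : (starRingEnd ℂ) (fourierHat f s) = fourierHat f s := by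
    rw [fourierHat, ← integral_conj, ← integral_neg_eq_self]
    congr 1
    ext x
    rw [map_mul, Complex.conj_ofReal, hf, ← Complex.exp_conj]
    simp
  exact (Complex.conj_eq_iff_re.mp h).symm

variable {Θ : Set (EuclideanSpace ℝ (Fin d))} {f g : EuclideanSpace ℝ (Fin d) → ℝ}

lemma mixtureDensity_eq_integral (hg : ∀ θ, θ ∉ Θ → g θ = 0) (x : EuclideanSpace ℝ (Fin d)) :
    mixtureDensity Θ f g x = ∫ θ, f (x - θ) * g θ :=
  setIntegral_eq_integral_of_forall_compl_eq_zero fun θ hθ => by rw [hg θ hθ, mul_zero]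

lemma mixtureDensity_nonneg (hf : ∀ x, 0 ≤ f x) (hg : ∀ x, 0 ≤ g x)
    (x : EuclideanSpace ℝ (Fin d)) : 0 ≤ mixtureDensity Θ f g x :=
  integral_nonneg fun θ => mul_nonneg (hf _) (hg θ)

lemma ofReal_mixtureDensity_eq_convolution (hg : ∀ θ, θ ∉ Θ → g θ = 0)
    (x : EuclideanSpace ℝ (Fin d)) : ((mixtureDensity Θ f g x : ℝ) : ℂ) =
      convolution (fun θ => (g θ : ℂ)) (fun θ => (f θ : ℂ)) (ContinuousLinearMap.mul ℂ ℂ)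
        volume x := by
  rw [mixtureDensity_eq_integral hg, ← integral_complex_ofReal, convolution_def]
  congr 1
  ext θ
  simp [mul_comm]

lemma integrable_mixtureDensity (hfi : Integrable f) (hgi : Integrable g)
    (hg : ∀ θ, θ ∉ Θ → g θ = 0) : Integrable (mixtureDensity Θ f g) := by
  have h := Integrable.integrable_convolution (ContinuousLinearMap.mul ℝ ℝ) hgi hfi
  refine h.congr (Filter.Eventually.of_forall fun x => ?_)
  rw [mixtureDensity_eq_integral hg, convolution_def]
  congr 1
  ext θ
  simp [mul_comm]

lemma fourierHat_mixtureDensity (hfi : Integrable f) (hgi : Integrable g)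
    (hg : ∀ θ, θ ∉ Θ → g θ = 0) (s : EuclideanSpace ℝ (Fin d)) :
    fourierHat (mixtureDensity Θ f g) s = fourierHat f s * fourierHat g s := by
  have hpi : (2 * Real.pi) ≠ 0 := by positivity
  have hf' : Integrable fun x => (f x : ℂ) := hfi.ofReal
  have hg' : Integrable fun x => (g x : ℂ) := hgi.ofReal
  obtain ⟨t, rfl⟩ : ∃ t, s = (2 * Real.pi) • t :=
    ⟨(2 * Real.pi)⁻¹ • s, by rw [smul_smul, mul_inv_cancel₀ hpi, one_smul]⟩
  simp_rw [fourierHat_eq_fourier, ofReal_mixtureDensity_eq_convolution hg]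
  rw [mul_comm]
  exact Real.fourier_mul_convolution_eq hg' hf' t

/-- Fubini, justified by the integrability of `p ⊗ w`, since the exponential has modulus one. -/
lemma integral_trigIntegral_sub_mul {w : EuclideanSpace ℝ (Fin d) → ℂ}
    {p : EuclideanSpace ℝ (Fin d) → ℝ} (hw : Integrable w) (hp : Integrable p)
    (θ : EuclideanSpace ℝ (Fin d)) :
    ∫ x, trigIntegral w (θ - x) * (p x : ℂ) = trigIntegral (fun s => w s * fourierHat p s) θ := by
  have hint : Integrable (Function.uncurry fun x s : EuclideanSpace ℝ (Fin d) =>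
      Complex.exp (Complex.I * ((inner ℝ s (θ - x) : ℝ) : ℂ)) * ((p x : ℂ) * w s))
      (volume.prod volume) := by
    have hp' : Integrable fun x => (p x : ℂ) := hp.ofReal
    have h := hp'.mul_prod hw
    refine h.mono (AEStronglyMeasurable.mul (Continuous.aestronglyMeasurable
      (by fun_prop)) h.1) (Filter.Eventually.of_forall fun z => ?_)
    simp only [Function.uncurry]
    rw [norm_mul, norm_exp_I_mul_ofReal, one_mul]
  calc ∫ x, trigIntegral w (θ - x) * (p x : ℂ)
      = ∫ x, ∫ s, Complex.exp (Complex.I * ((inner ℝ s (θ - x) : ℝ) : ℂ)) * ((p x : ℂ) * w s) := by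
        congr 1
        ext x
        rw [trigIntegral, ← integral_mul_const]
        congr 1
        ext s
        ring
    _ = ∫ s, ∫ x, Complex.exp (Complex.I * ((inner ℝ s (θ - x) : ℝ) : ℂ)) * ((p x : ℂ) * w s) :=
        integral_integral_swap hint
    _ = _ := by
        rw [trigIntegral]
        congr 1
        ext s
        rw [fourierHat, ← integral_const_mul, ← integral_const_mul]
        congr 1
        ext x
        rw [inner_sub_right, Complex.ofReal_sub, mul_sub, sub_eq_add_neg, Complex.exp_add]
        ring

lemma integral_comp_of_map_eq_withDensity {Ω F : Type*} [MeasurableSpace Ω] [NormedAddCommGroup F]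
    [NormedSpace ℝ F] {P : Measure Ω}
    {X : Ω → EuclideanSpace ℝ (Fin d)} {p : EuclideanSpace ℝ (Fin d) → ℝ}
    (hX : AEMeasurable X P) (hlaw : P.map X = volume.withDensity fun x => ENNReal.ofReal (p x))
    (hp : AEMeasurable p) (hp0 : ∀ x, 0 ≤ p x) {φ : EuclideanSpace ℝ (Fin d) → F}
    (hφ : Continuous φ) :
    ∫ ω, φ (X ω) ∂P = ∫ x, p x • φ x := by
  rw [← integral_map hX hφ.aestronglyMeasurable, hlaw,
    integral_withDensity_eq_integral_toReal_smul₀ hp.ennreal_ofReal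
      (Filter.Eventually.of_forall fun _ => ENNReal.ofReal_lt_top)]
  congr 1
  ext x
  rw [ENNReal.toReal_ofReal (hp0 x)]

lemma integral_re_trigIntegral_sub {Ω : Type*} [MeasurableSpace Ω] {P : Measure Ω}
    {X : Ω → EuclideanSpace ℝ (Fin d)} {p : EuclideanSpace ℝ (Fin d) → ℝ}
    (hX : AEMeasurable X P) (hlaw : P.map X = volume.withDensity fun x => ENNReal.ofReal (p x))
    (hp : Integrable p) (hp0 : ∀ x, 0 ≤ p x) {w : EuclideanSpace ℝ (Fin d) → ℂ}
    (hw : Integrable w) (θ : EuclideanSpace ℝ (Fin d)) :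
    ∫ ω, (trigIntegral w (θ - X ω)).re ∂P =
      (trigIntegral (fun s => w s * fourierHat p s) θ).re := by
  have hcont : Continuous fun x => trigIntegral w (θ - x) :=
    (continuous_trigIntegral hw).comp (by fun_prop)
  have hcr : Continuous fun x => (trigIntegral w (θ - x)).re := Complex.continuous_re.comp hcont
  rw [integral_comp_of_map_eq_withDensity hX hlaw hp.1.aemeasurable hp0 hcr,
    ← integral_trigIntegral_sub_mul hw hp]
  have hint : Integrable fun x => trigIntegral w (θ - x) * (p x : ℂ) := by
    have hp' : Integrable fun x => (p x : ℂ) := hp.ofReal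
    exact hp'.bdd_mul hcont.aestronglyMeasurable
      (Filter.Eventually.of_forall fun x => norm_trigIntegral_le w _)
  have := Complex.reCLM.integral_comp_comm hint
  simp only [Complex.reCLM_apply] at this
  rw [← this]
  congr 1
  ext x
  rw [Complex.re_mul_ofReal, smul_eq_mul, mul_comm]

end Densities

/-! ### The estimator as a trigonometric integral -/

section Estimator

variable {d : ℕ}

/-- The multiplier `i^m ∏ₖ s_{uₖ}` of the partial derivative `∂_{u₁} ⋯ ∂_{uₘ}`. -/
noncomputable def partialMultiplier {m : ℕ} (u : Fin m → Fin d) (s : EuclideanSpace ℝ (Fin d)) :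
    ℂ :=
  Complex.I ^ m * ((∏ k, s (u k) : ℝ) : ℂ)

lemma norm_partialMultiplier {m : ℕ} (u : Fin m → Fin d) (s : EuclideanSpace ℝ (Fin d)) :
    ‖partialMultiplier u s‖ = ∏ k, |s (u k)| := by
  rw [partialMultiplier, norm_mul, norm_pow, Complex.norm_I, one_pow, one_mul, Complex.norm_real,
    norm_prod]
  rfl

lemma prod_inner_single {m : ℕ} (u : Fin m → Fin d) (s : EuclideanSpace ℝ (Fin d)) :
    ∏ k, inner ℝ s (EuclideanSpace.single (u k) (1 : ℝ)) = ∏ k, s (u k) := by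
  simp [EuclideanSpace.inner_single_right]

lemma integrable_partialMultiplier_mul {h : EuclideanSpace ℝ (Fin d) → ℂ} {m : ℕ}
    (hh : Integrable fun s => ‖s‖ ^ m * ‖h s‖) (hm : AEStronglyMeasurable h)
    (u : Fin m → Fin d) : Integrable fun s => partialMultiplier u s * h s := by
  have := integrable_prod_inner_mul hh hm fun k => EuclideanSpace.single (u k) (1 : ℝ)
  simpa only [prod_inner_single, partialMultiplier] using this

lemma iteratedFDeriv_re_trigIntegral_single {h : EuclideanSpace ℝ (Fin d) → ℂ} {m : ℕ}
    (hh : ∀ n, Integrable fun s => ‖s‖ ^ n * ‖h s‖) (hm : AEStronglyMeasurable h)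
    (u : Fin m → Fin d) (y : EuclideanSpace ℝ (Fin d)) :
    iteratedFDeriv ℝ m (fun y => (trigIntegral h y).re) y
      (fun k => EuclideanSpace.single (u k) (1 : ℝ)) =
      (trigIntegral (fun s => partialMultiplier u s * h s) y).re := by
  rw [iteratedFDeriv_re_trigIntegral (N := m) (fun n _ => hh n) hm le_rfl]
  simp only [prod_inner_single, partialMultiplier]

lemma contDiff_re_trigIntegral {h : EuclideanSpace ℝ (Fin d) → ℂ}
    (hh : ∀ n, Integrable fun s => ‖s‖ ^ n * ‖h s‖) (m : ℕ) :
    ContDiff ℝ (m : ℕ∞) fun y => (trigIntegral h y).re :=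
  Complex.reCLM.contDiff.comp (contDiff_trigIntegral fun n _ => hh n)

/-- The truncated inverse `1_{[-R,R]^d} / f̂` of the Fourier transform of `f`. -/
noncomputable def deconvWeight (f : EuclideanSpace ℝ (Fin d) → ℝ) (R : ℝ) :
    EuclideanSpace ℝ (Fin d) → ℂ :=
  (cube d R).indicator fun s => (((fourierHat f s).re)⁻¹ : ℝ)

variable {f : EuclideanSpace ℝ (Fin d) → ℝ} {R : ℝ}

lemma measurable_deconvWeight (hf : Integrable f) : Measurable (deconvWeight f R) := by
  refine Measurable.indicator ?_ (measurableSet_cube d R)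
  have := (continuous_fourierHat hf).measurable
  fun_prop

/-- On the cube each `|s j| ^ α` is at most `R ^ α`; the sum over the `d` coordinates is the source
of the `d` in the exponent of the variance bound. -/
lemma norm_deconvWeight_le {α c C : ℝ} (hα : 0 < α) (heven : ∀ x, f (-x) = f x)
    (hlow : IsLowerSupersmooth f α c C) (s : EuclideanSpace ℝ (Fin d)) :
    ‖deconvWeight f R s‖ ≤
      (cube d R).indicator (fun _ => c⁻¹ * Real.exp (C * (d * R ^ α))) s := by
  by_cases hs : s ∈ cube d R
  · rw [deconvWeight, Set.indicator_of_mem hs, Set.indicator_of_mem hs, Complex.norm_real, norm_inv]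
    have h1 : ‖(fourierHat f s).re‖ = ‖fourierHat f s‖ := by
      conv_rhs => rw [fourierHat_eq_re_of_even heven s, Complex.norm_real]
    have h2 : ∑ j, |s j| ^ α ≤ d * R ^ α := by
      calc ∑ j, |s j| ^ α ≤ ∑ _j : Fin d, R ^ α := by
            refine Finset.sum_le_sum fun j _ => ?_
            exact Real.rpow_le_rpow (abs_nonneg _) (abs_le.mpr (hs j)) hα.le
        _ = _ := by simp
    have hc := hlow.const_pos
    have hC := hlow.rate_pos
    have h3 : c * Real.exp (-(C * (d * R ^ α))) ≤ ‖fourierHat f s‖ := by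
      refine le_trans ?_ (hlow.bound s)
      gcongr
    rw [h1]
    calc ‖fourierHat f s‖⁻¹ ≤ (c * Real.exp (-(C * (d * R ^ α))))⁻¹ := by
          gcongr
      _ = _ := by rw [mul_inv, Real.exp_neg, inv_inv]
  · rw [deconvWeight, Set.indicator_of_notMem hs, Set.indicator_of_notMem hs, norm_zero]

lemma integral_indicator_cube_const (hR : 0 ≤ R) (b : ℝ) :
    ∫ s : EuclideanSpace ℝ (Fin d), (cube d R).indicator (fun _ => b) s = (2 * R) ^ d * b := by
  rw [integral_indicator_const _ (measurableSet_cube d R), measureReal_def, volume_cube d hR,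
    ENNReal.toReal_ofReal (by positivity), smul_eq_mul]

lemma integrable_indicator_cube_const (hR : 0 ≤ R) (b : ℝ) :
    Integrable ((cube d R).indicator fun _ => b) :=
  (integrable_indicator_iff (measurableSet_cube d R)).mpr
    (integrableOn_const (by rw [volume_cube d hR]; exact ENNReal.ofReal_ne_top))

/-- A bounded weight supported in a cube has all moments, which makes the estimator smooth to every
order. -/
lemma integrable_norm_pow_mul_deconvWeight {α c C : ℝ} (hα : 0 < α) (hR : 0 ≤ R)
    (hf : Integrable f) (heven : ∀ x, f (-x) = f x) (hlow : IsLowerSupersmooth f α c C) (n : ℕ) :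
    Integrable fun s => ‖s‖ ^ n * ‖deconvWeight f R s‖ := by
  refine (integrable_indicator_cube_const (d := d) hR
    (((1 + R) ^ d) ^ n * (c⁻¹ * Real.exp (C * (d * R ^ α))))).mono'
    ((measurable_norm.pow_const n).mul (measurable_deconvWeight hf).norm).aestronglyMeasurable
    (Filter.Eventually.of_forall fun s => ?_)
  rw [Real.norm_of_nonneg (by positivity)]
  have h := norm_deconvWeight_le (R := R) hα heven hlow s
  by_cases hs : s ∈ cube d R
  · rw [Set.indicator_of_mem hs] at h ⊢
    have h1 : ‖s‖ ≤ (1 + R) ^ d := by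
      refine (norm_le_prod_one_add_abs s).trans ?_
      calc ∏ j, (1 + |s j|) ≤ ∏ _j : Fin d, (1 + R) :=
            Finset.prod_le_prod (fun j _ => by positivity) fun j _ => by
              linarith [abs_le.mpr (hs j)]
        _ = _ := by simp
    gcongr
  · rw [deconvWeight, Set.indicator_of_notMem hs, Set.indicator_of_notMem hs, norm_zero, mul_zero]

lemma integral_norm_partialMultiplier_mul_deconvWeight_le {α c C : ℝ} (hα : 0 < α) (hR : 0 ≤ R)
    (heven : ∀ x, f (-x) = f x) (hlow : IsLowerSupersmooth f α c C) {m : ℕ} (u : Fin m → Fin d) :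
    ∫ s, ‖partialMultiplier u s * deconvWeight f R s‖ ≤
      (2 * R) ^ d * (R ^ m * (c⁻¹ * Real.exp (C * (d * R ^ α)))) := by
  rw [← integral_indicator_cube_const hR]
  refine integral_mono_of_nonneg (Filter.Eventually.of_forall fun s => norm_nonneg _)
    (integrable_indicator_cube_const hR _) (Filter.Eventually.of_forall fun s => ?_)
  simp only
  have h := norm_deconvWeight_le (R := R) hα heven hlow s
  rw [norm_mul, norm_partialMultiplier]
  by_cases hs : s ∈ cube d R
  · rw [Set.indicator_of_mem hs] at h ⊢
    gcongr
    calc ∏ k, |s (u k)| ≤ ∏ _k : Fin m, R :=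
          Finset.prod_le_prod (fun k _ => abs_nonneg _) fun k _ => abs_le.mpr (hs (u k))
      _ = _ := by simp
  · rw [deconvWeight, Set.indicator_of_notMem hs, Set.indicator_of_notMem hs, norm_zero, mul_zero]

/-- The weight is real, so only the cosine survives in the real part. -/
lemma setIntegral_cube_cos_div (hw : Integrable (deconvWeight f R))
    (y : EuclideanSpace ℝ (Fin d)) :
    ∫ s in cube d R, Real.cos (inner ℝ s y) / (fourierHat f s).re =
      (trigIntegral (deconvWeight f R) y).re := by
  have := Complex.reCLM.integral_comp_comm (integrable_exp_inner_mul hw y)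
  simp only [Complex.reCLM_apply] at this
  rw [trigIntegral, ← this, ← integral_indicator (measurableSet_cube d R)]
  congr 1
  ext s
  by_cases hs : s ∈ cube d R
  · rw [deconvWeight, Set.indicator_of_mem hs, Set.indicator_of_mem hs, Complex.re_mul_ofReal,
      mul_comm Complex.I, Complex.exp_ofReal_mul_I_re, div_eq_mul_inv]
  · rw [deconvWeight, Set.indicator_of_notMem hs, Set.indicator_of_notMem hs, mul_zero,
      Complex.zero_re]

lemma deconvEstimator_eq {n : ℕ} (hw : Integrable (deconvWeight f R))
    (x : Fin n → EuclideanSpace ℝ (Fin d)) :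
    deconvEstimator f R x = fun θ => (1 / ((n : ℝ) * (2 * Real.pi) ^ d)) •
      ∑ j, (trigIntegral (deconvWeight f R) (θ - x j)).re := by
  ext θ
  simp only [deconvEstimator, setIntegral_cube_cos_div hw, smul_eq_mul]

lemma contDiff_deconvEstimator {n : ℕ}
    (hh : ∀ k, Integrable fun s => ‖s‖ ^ k * ‖deconvWeight f R s‖)
    (hw : Integrable (deconvWeight f R)) (x : Fin n → EuclideanSpace ℝ (Fin d)) (m : ℕ) :
    ContDiff ℝ (m : ℕ∞) (deconvEstimator f R x) := by
  rw [deconvEstimator_eq hw]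
  refine ContDiff.const_smul _ (ContDiff.sum fun j _ => ?_)
  exact (contDiff_re_trigIntegral hh m).comp (contDiff_id.sub contDiff_const)

lemma nabla_deconvEstimator_apply {n m : ℕ}
    (hh : ∀ k, Integrable fun s => ‖s‖ ^ k * ‖deconvWeight f R s‖)
    (hw : Integrable (deconvWeight f R)) (x : Fin n → EuclideanSpace ℝ (Fin d))
    (θ : EuclideanSpace ℝ (Fin d)) (u : Fin m → Fin d) :
    nabla m (deconvEstimator f R x) θ u = 1 / ((n : ℝ) * (2 * Real.pi) ^ d) *
      ∑ j, (trigIntegral (fun s => partialMultiplier u s * deconvWeight f R s) (θ - x j)).re := by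
  have hc : ∀ j, ContDiff ℝ m fun θ => (trigIntegral (deconvWeight f R) (θ - x j)).re :=
    fun j => ((contDiff_re_trigIntegral hh m).comp
      (contDiff_id.sub contDiff_const : ContDiff ℝ m fun θ => θ - x j))
  show iteratedFDeriv ℝ m (deconvEstimator f R x) θ _ = _
  rw [deconvEstimator_eq hw, iteratedFDeriv_const_smul_apply'
    (ContDiff.sum fun j _ => hc j).contDiffAt,
    iteratedFDeriv_fun_sum_apply fun j _ => (hc j).contDiffAt]
  simp only [smul_apply, sum_apply, smul_eq_mul]
  congr 1
  refine Finset.sum_congr rfl fun j _ => ?_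
  rw [← iteratedFDeriv_re_trigIntegral_single hh hw.1 u,
    iteratedFDeriv_comp_sub (f := fun y => (trigIntegral (deconvWeight f R) y).re)]

end Estimator

/-! ### Derivatives of the mixing density and the truncation error -/

section MixingDensity

variable {d : ℕ} {Θ : Set (EuclideanSpace ℝ (Fin d))} {g : EuclideanSpace ℝ (Fin d) → ℝ}
  {α C C₁ : ℝ}

/-- A disagreement at one point of `Θ` would persist, by continuity, on a relative neighbourhood,
which has nonzero measure. -/
lemma IsParameterSet.eqOn_of_ae_eq (hΘ : IsParameterSet Θ) {h : EuclideanSpace ℝ (Fin d) → ℝ}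
    (hg : ContinuousOn g Θ) (hh : Continuous h) (hgh : g =ᵐ[volume] h) : Set.EqOn g h Θ := by
  intro θ hθ
  by_contra hne
  have h1 : ∀ᶠ x in 𝓝[Θ] θ, g x - h x ≠ 0 :=
    ((hg θ hθ).sub hh.continuousWithinAt).eventually_ne (sub_ne_zero.mpr hne)
  obtain ⟨U, hU, hUs⟩ := mem_nhdsWithin_iff_exists_mem_nhds_inter.mp h1
  refine hΘ.volume_ne_zero θ hθ U hU (measure_mono_null (fun x hx => ?_) (ae_iff.mp hgh))
  exact sub_ne_zero.mp (hUs hx)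

lemma IsUpperSupersmooth.integrable_norm_pow_mul (hα : 0 < α) (hg : Integrable g)
    (hup : IsUpperSupersmooth g α C C₁) (n : ℕ) :
    Integrable fun s => ‖s‖ ^ n * ‖fourierHat g s‖ := by
  refine ((integrable_norm_pow_mul_exp_neg hα hup.rate_pos n).const_mul C).mono'
    ((measurable_norm.pow_const n).mul
      (continuous_fourierHat hg).measurable.norm).aestronglyMeasurable
    (Filter.Eventually.of_forall fun s => ?_)
  rw [Real.norm_of_nonneg (by positivity), mul_left_comm]
  exact mul_le_mul_of_nonneg_left (hup.bound s) (by positivity)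

lemma IsUpperSupersmooth.integrable_fourierHat (hα : 0 < α) (hg : Integrable g)
    (hup : IsUpperSupersmooth g α C C₁) : Integrable (fourierHat g) := by
  rw [← integrable_norm_iff (continuous_fourierHat hg).aestronglyMeasurable]
  simpa using hup.integrable_norm_pow_mul hα hg 0

/-- On `Θ` the inversion formula extends `g` to a function smooth on the whole space, so unique
differentiability replaces derivatives within `Θ` by ordinary ones. -/
lemma nablaWithin_apply_eq_trigIntegral (hΘ : IsParameterSet Θ) (hα : 0 < α) (hg : Integrable g)
    (hup : IsUpperSupersmooth g α C C₁) (hgc : ContinuousOn g Θ) {θ : EuclideanSpace ℝ (Fin d)}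
    (hθ : θ ∈ Θ) {m : ℕ} (u : Fin m → Fin d) :
    nablaWithin m Θ g θ u = ((2 * Real.pi) ^ d)⁻¹ *
      (trigIntegral (fun s => partialMultiplier u s * fourierHat g s) θ).re := by
  have hmom := hup.integrable_norm_pow_mul hα hg
  have hint := hup.integrable_fourierHat hα hg
  have hsm : ContDiff ℝ m fun θ =>
      ((2 * Real.pi) ^ d)⁻¹ • (trigIntegral (fourierHat g) θ).re :=
    (contDiff_re_trigIntegral hmom m).const_smul _
  have heq : Set.EqOn g (fun θ => ((2 * Real.pi) ^ d)⁻¹ • (trigIntegral (fourierHat g) θ).re) Θ := by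
    refine hΘ.eqOn_of_ae_eq hgc hsm.continuous ?_
    filter_upwards [ae_eq_trigIntegral_fourierHat hg hint] with x hx
    have := congrArg Complex.re hx
    rwa [Complex.ofReal_re, Complex.re_ofReal_mul] at this
  show iteratedFDerivWithin ℝ m g Θ θ _ = _
  rw [iteratedFDerivWithin_congr heq hθ,
    iteratedFDerivWithin_eq_iteratedFDeriv hΘ.uniqueDiffOn hsm.contDiffAt hθ,
    iteratedFDeriv_const_smul_apply' (contDiff_re_trigIntegral hmom m).contDiffAt, smul_apply,
    iteratedFDeriv_re_trigIntegral_single hmom hint.1, smul_eq_mul]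

lemma norm_trigIntegral_indicator_cube_sub_le {R : ℝ} (hα : 0 < α) (hg : Integrable g)
    (hup : IsUpperSupersmooth g α C C₁) {m : ℕ} (u : Fin m → Fin d)
    (θ : EuclideanSpace ℝ (Fin d)) (hR0 : 0 < R) (hR : 2 * (m + 1 + α) ≤ C₁ * α * R ^ α) :
    ‖trigIntegral ((cube d R).indicator fun s => partialMultiplier u s * fourierHat g s) θ -
        trigIntegral (fun s => partialMultiplier u s * fourierHat g s) θ‖ ≤
      C * (d * ((4 / (C₁ * α) * (R ^ ((m : ℝ) + 1 - α) * Real.exp (-(C₁ * R ^ α)))) *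
        (∫ t : ℝ, Real.exp (-(C₁ * |t| ^ α))) ^ (d - 1))) := by
  have hC := hup.const_pos
  have hint : Integrable fun s => partialMultiplier u s * fourierHat g s :=
    integrable_partialMultiplier_mul (hup.integrable_norm_pow_mul hα hg m)
      (continuous_fourierHat hg).aestronglyMeasurable u
  have hexp := integrable_exp_inner_mul hint θ
  have hcube : trigIntegral
      ((cube d R).indicator fun s => partialMultiplier u s * fourierHat g s) θ =
      ∫ s in cube d R, Complex.exp (Complex.I * ((inner ℝ s θ : ℝ) : ℂ)) *
        (partialMultiplier u s * fourierHat g s) := by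
    rw [trigIntegral, ← integral_indicator (measurableSet_cube d R)]
    congr 1
    ext s
    by_cases hs : s ∈ cube d R
    · rw [Set.indicator_of_mem hs, Set.indicator_of_mem hs]
    · rw [Set.indicator_of_notMem hs, Set.indicator_of_notMem hs, mul_zero]
  rw [hcube, trigIntegral, ← integral_add_compl (measurableSet_cube d R) hexp, sub_add_cancel_left,
    norm_neg]
  refine (norm_integral_le_integral_norm _).trans ?_
  have hdom : Integrable fun s : EuclideanSpace ℝ (Fin d) =>
      (∏ k, |s (u k)|) * Real.exp (-(C₁ * ∑ j, |s j| ^ α)) := by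
    refine (integrable_norm_pow_mul_exp_neg hα hup.rate_pos m).mono'
      (Measurable.aestronglyMeasurable (by fun_prop)) (Filter.Eventually.of_forall fun s => ?_)
    rw [Real.norm_of_nonneg (by positivity)]
    gcongr
    calc ∏ k, |s (u k)| ≤ ∏ _k : Fin m, ‖s‖ :=
          Finset.prod_le_prod (fun k _ => abs_nonneg _) fun k _ => PiLp.norm_apply_le s (u k)
      _ = _ := by simp
  calc _ ≤ ∫ s in (cube d R)ᶜ, C * ((∏ k, |s (u k)|) *
          Real.exp (-(C₁ * ∑ j, |s j| ^ α))) := by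
        refine integral_mono hexp.norm.integrableOn (hdom.const_mul C).integrableOn fun s => ?_
        simp only
        rw [norm_mul, norm_exp_I_mul_ofReal, one_mul, norm_mul, norm_partialMultiplier,
          mul_left_comm]
        exact mul_le_mul_of_nonneg_left (hup.bound s) (by positivity)
    _ ≤ _ := by
        rw [integral_const_mul]
        exact mul_le_mul_of_nonneg_left
          (integral_cube_compl_prod_abs_mul_exp_le hα hup.rate_pos u hR0 hR) hC.le

end MixingDensity

/-! ### Variance of sums over the sample -/

section SampleMean

variable {Ω E : Type*} [MeasurableSpace Ω] {P : Measure Ω} [IsProbabilityMeasure P]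
  [MeasurableSpace E] {n : ℕ} {X : Fin n → Ω → E}

lemma variance_const_mul_sum_comp_le (hX : ∀ j, AEMeasurable (X j) P) (hindep : iIndepFun X P)
    {φ : E → ℝ} (hφ : Measurable φ) {M : ℝ} (hM : ∀ x, |φ x| ≤ M) (a : ℝ) :
    Var[fun ω => a * ∑ j, φ (X j ω); P] ≤ a ^ 2 * (n * M ^ 2) := by
  have hmem : ∀ j, MemLp (fun ω => φ (X j ω)) 2 P := fun j =>
    MemLp.of_bound (hφ.comp_aemeasurable (hX j)).aestronglyMeasurable M
      (Filter.Eventually.of_forall fun ω => hM _)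
  have hsum : (fun ω => ∑ j, φ (X j ω)) = ∑ j, fun ω => φ (X j ω) := by
    ext ω; rw [Finset.sum_apply]
  rw [variance_const_mul, hsum, IndepFun.variance_sum (fun j _ => hmem j) fun i _ j _ hij =>
    (hindep.indepFun hij).comp hφ hφ]
  refine mul_le_mul_of_nonneg_left ?_ (sq_nonneg a)
  calc ∑ j, Var[fun ω => φ (X j ω); P] ≤ ∑ _j : Fin n, M ^ 2 := by
        refine Finset.sum_le_sum fun j _ => ?_
        refine (variance_le_expectation_sq (hmem j).1).trans ?_
        calc ∫ ω, ((fun ω => φ (X j ω)) ^ 2) ω ∂P ≤ ∫ _ω, M ^ 2 ∂P := by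
              refine integral_mono (hmem j).integrable_sq (integrable_const _) fun ω => ?_
              exact (sq_abs (φ (X j ω))).symm.trans_le
                (pow_le_pow_left₀ (abs_nonneg _) (hM _) 2)
          _ = M ^ 2 := by simp
    _ = _ := by simp

lemma memLp_const_mul_sum_comp (hX : ∀ j, AEMeasurable (X j) P)
    {φ : E → ℝ} (hφ : Measurable φ) {M : ℝ} (hM : ∀ x, |φ x| ≤ M) (a : ℝ) :
    MemLp (fun ω => a * ∑ j, φ (X j ω)) 2 P := by
  have hmem : ∀ j, MemLp (fun ω => φ (X j ω)) 2 P := fun j =>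
    MemLp.of_bound (hφ.comp_aemeasurable (hX j)).aestronglyMeasurable M
      (Filter.Eventually.of_forall fun ω => hM _)
  have hsum : MemLp (fun ω => ∑ j, φ (X j ω)) 2 P := memLp_finsetSum _ fun j _ => hmem j
  exact hsum.const_mul a

end SampleMean

/-! ### Entrywise reduction for random tensors -/

section EuclideanVectors

variable {Ω ι : Type*} [MeasurableSpace Ω] {P : Measure Ω} [Fintype ι]
  {Y : Ω → EuclideanSpace ℝ ι}

lemma MeasureTheory.norm_sq_sub_integral_eq_sum (hY : ∀ u, Integrable (fun ω => Y ω u) P) (ω : Ω) :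
    ‖Y ω - ∫ ω', Y ω' ∂P‖ ^ 2 = ∑ u, (Y ω u - ∫ ω', Y ω' u ∂P) ^ 2 := by
  rw [EuclideanSpace.norm_sq_eq]
  refine Finset.sum_congr rfl fun u _ => ?_
  rw [PiLp.sub_apply, eval_integral_piLp hY, Real.norm_eq_abs, sq_abs]

lemma integrable_norm_sq_sub_integral [IsProbabilityMeasure P]
    (hY : ∀ u, MemLp (fun ω => Y ω u) 2 P) :
    Integrable (fun ω => ‖Y ω - ∫ ω', Y ω' ∂P‖ ^ 2) P := by
  simp_rw [norm_sq_sub_integral_eq_sum fun u => (hY u).integrable one_le_two]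
  exact integrable_finsetSum _ fun u _ => ((hY u).sub (memLp_const _)).integrable_sq

/-- The expected squared Euclidean deviation is the sum of the variances of the entries. -/
lemma integral_norm_sq_sub_integral_le [IsProbabilityMeasure P]
    (hY : ∀ u, MemLp (fun ω => Y ω u) 2 P) {v : ℝ} (hv : ∀ u, Var[fun ω => Y ω u; P] ≤ v) :
    ∫ ω, ‖Y ω - ∫ ω', Y ω' ∂P‖ ^ 2 ∂P ≤ Fintype.card ι * v := by
  simp_rw [norm_sq_sub_integral_eq_sum fun u => (hY u).integrable one_le_two]
  have hint : ∀ u, Integrable (fun ω => (Y ω u - ∫ ω', Y ω' u ∂P) ^ 2) P :=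
    fun u => ((hY u).sub (memLp_const _)).integrable_sq
  rw [integral_finsetSum _ fun u _ => hint u]
  calc _ ≤ ∑ _u : ι, v := by
        refine Finset.sum_le_sum fun u _ => ?_
        rw [← variance_eq_integral (hY u).1.aemeasurable]
        exact hv u
    _ = _ := by simp

/-- Nonnegativity of `b` covers an empty index set, where the supremum is `0`. -/
lemma maxNorm_le {T : EuclideanSpace ℝ ι} {b : ℝ} (hb : 0 ≤ b) (hT : ∀ u, |T u| ≤ b) :
    maxNorm T ≤ b :=
  Real.iSup_le hT hb

end EuclideanVectors

/-! ### The mean of the estimator's derivatives -/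

section Deconvolution

variable {d n m : ℕ} {Θ : Set (EuclideanSpace ℝ (Fin d))} {f g : EuclideanSpace ℝ (Fin d) → ℝ}
  {Ω : Type*} [MeasurableSpace Ω] {P : Measure Ω} [IsProbabilityMeasure P]
  {X : Fin n → Ω → EuclideanSpace ℝ (Fin d)} {R α c C : ℝ}

/-- The deconvolution step: lower supersmoothness keeps `fourierHat f` away from zero, so it cancels
on the cube. -/
lemma partialMultiplier_mul_deconvWeight_mul_fourierHat (hfi : Integrable f)
    (heven : ∀ x, f (-x) = f x) (hlow : IsLowerSupersmooth f α c C) (hgi : Integrable g)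
    (hg : ∀ θ, θ ∉ Θ → g θ = 0) (u : Fin m → Fin d) (s : EuclideanSpace ℝ (Fin d)) :
    partialMultiplier u s * deconvWeight f R s * fourierHat (mixtureDensity Θ f g) s =
      (cube d R).indicator (fun s => partialMultiplier u s * fourierHat g s) s := by
  by_cases hs : s ∈ cube d R
  · have hne : fourierHat f s ≠ 0 :=
      norm_pos_iff.mp ((mul_pos hlow.const_pos (Real.exp_pos _)).trans_le (hlow.bound s))
    rw [deconvWeight, Set.indicator_of_mem hs, Set.indicator_of_mem hs,
      fourierHat_mixtureDensity hfi hgi hg, Complex.ofReal_inv, ← fourierHat_eq_re_of_even heven]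
    field_simp
  · rw [deconvWeight, Set.indicator_of_notMem hs, Set.indicator_of_notMem hs, mul_zero, zero_mul]

lemma integral_nabla_deconvEstimator_apply (hX : IsIIDSample P X (mixtureDensity Θ f g))
    (hn : 1 ≤ n) (hf : IsDensity f) (heven : ∀ x, f (-x) = f x)
    (hlow : IsLowerSupersmooth f α c C) (hgd : IsDensity g) (hg : ∀ θ, θ ∉ Θ → g θ = 0)
    (hh : ∀ k, Integrable fun s => ‖s‖ ^ k * ‖deconvWeight f R s‖)
    (hw : Integrable (deconvWeight f R)) (θ : EuclideanSpace ℝ (Fin d)) (u : Fin m → Fin d) :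
    ∫ ω, nabla m (deconvEstimator f R fun j => X j ω) θ u ∂P = ((2 * Real.pi) ^ d)⁻¹ *
      (trigIntegral ((cube d R).indicator
        fun s => partialMultiplier u s * fourierHat g s) θ).re := by
  have hpw := integrable_partialMultiplier_mul (hh m) hw.1 u
  have hterm : ∀ j, ∫ ω, (trigIntegral (fun s => partialMultiplier u s * deconvWeight f R s)
      (θ - X j ω)).re ∂P = (trigIntegral ((cube d R).indicator
        fun s => partialMultiplier u s * fourierHat g s) θ).re := fun j => by
    rw [integral_re_trigIntegral_sub (hX.aemeasurable j) (hX.law j)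
      (integrable_mixtureDensity hf.integrable hgd.integrable hg)
      (mixtureDensity_nonneg hf.nonneg hgd.nonneg) hpw]
    simp_rw [partialMultiplier_mul_deconvWeight_mul_fourierHat hf.integrable heven hlow
      hgd.integrable hg u]
  have hint : ∀ j, Integrable (fun ω => (trigIntegral
      (fun s => partialMultiplier u s * deconvWeight f R s) (θ - X j ω)).re) P := fun j => by
    have hc : Continuous fun x => (trigIntegral
        (fun s => partialMultiplier u s * deconvWeight f R s) (θ - x)).re :=
      Complex.continuous_re.comp ((continuous_trigIntegral hpw).comp (by fun_prop))
    exact Integrable.of_bound (hc.measurable.comp_aemeasurable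
      (hX.aemeasurable j)).aestronglyMeasurable _ (Filter.Eventually.of_forall fun ω =>
        (Complex.abs_re_le_norm _).trans (norm_trigIntegral_le _ _))
  simp_rw [nabla_deconvEstimator_apply hh hw]
  rw [integral_const_mul, integral_finsetSum _ fun j _ => hint j]
  simp_rw [hterm]
  have hn' : (n : ℝ) ≠ 0 := by positivity
  simp only [Finset.sum_const, Finset.card_univ, Fintype.card_fin, nsmul_eq_mul]
  field_simp

end Deconvolution

/-! ### Assembly of the bias and variance bounds -/

theorem theorem7 (d r : ℕ) (α₁ α₂ C C₁ c C₂ : ℝ) (hα₁ : 0 < α₁) (hα : α₁ ≤ α₂) :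
    ∃ (C' : ℝ) (K L : ℕ → ℝ), 0 < C' ∧
      ∀ (Θ : Set (EuclideanSpace ℝ (Fin d))) (f g : EuclideanSpace ℝ (Fin d) → ℝ),
        IsParameterSet Θ →
        IsDensity f → (∀ x, f (-x) = f x) → IsLowerSupersmooth f α₁ c C₂ →
        IsDensity g → (∀ θ, θ ∉ Θ → g θ = 0) → IsUpperSupersmooth g α₂ C C₁ →
        eLpNorm g ⊤ volume < ⊤ → IsBoundedIntegrableCr r Θ g →
        ∀ (n : ℕ), 1 ≤ n →
        ∀ (Ω : Type*) [MeasurableSpace Ω] (P : Measure Ω) [IsProbabilityMeasure P]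
          (X : Fin n → Ω → EuclideanSpace ℝ (Fin d)),
        IsIIDSample P X (mixtureDensity Θ f g) →
        ∀ R : ℝ, C' ≤ R → ∀ i : ℕ, 1 ≤ i → i ≤ r →
          (∀ ω, ContDiff ℝ (i : ℕ∞) (deconvEstimator f R fun j => X j ω)) ∧
          ∀ θ ∈ Θ,
            Integrable (fun ω => nabla i (deconvEstimator f R fun j => X j ω) θ) P ∧
            maxNorm ((∫ ω, nabla i (deconvEstimator f R fun j => X j ω) θ ∂P)
                - nablaWithin i Θ g θ)
              ≤ K i * R ^ max ((i : ℝ) + 1 - α₂) 0 * Real.exp (-(C₁ * R ^ α₂)) ∧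
            Integrable (fun ω => ‖nabla i (deconvEstimator f R fun j => X j ω) θ
              - ∫ ω', nabla i (deconvEstimator f R fun j => X j ω') θ ∂P‖ ^ 2) P ∧
            ∫ ω, ‖nabla i (deconvEstimator f R fun j => X j ω) θ
                - ∫ ω', nabla i (deconvEstimator f R fun j => X j ω') θ ∂P‖ ^ 2 ∂P
              ≤ L i * (R ^ (2 * (i + d)) * Real.exp (2 * C₂ * d * R ^ α₁) / n) := by
  have hα₂ : 0 < α₂ := hα₁.trans_le hα
  set A : ℝ := ∫ t : ℝ, Real.exp (-(C₁ * |t| ^ α₂)) with hA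
  -- The second entry of the maximum forces `C₁ α₂ R^α₂ ≥ 2 (r + 1 + α₂)`, the tail condition for
  -- all `i ≤ r` at once; the entry `1` makes powers of `R` monotone in the exponent and keeps the
  -- threshold positive before the signs of the constants are known. The factor `d ^ i` counts the
  -- entries of the tensor.
  refine ⟨max 1 ((2 * (r + 1 + α₂) / (C₁ * α₂)) ^ α₂⁻¹),
    fun _ => ((2 * Real.pi) ^ d)⁻¹ * (C * (d * (4 / (C₁ * α₂) * A ^ (d - 1)))),
    fun i => (d : ℝ) ^ i * (((2 * Real.pi) ^ d)⁻¹ * 2 ^ d * c⁻¹) ^ 2,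
    lt_max_of_lt_left one_pos, ?_⟩
  intro Θ f g hΘ hf heven hlow hgd hg hup _ hgr n hn Ω _ P _ X hX R hR i _ hir
  have hR1 : 1 ≤ R := (le_max_left _ _).trans hR
  have hR0 : 0 < R := one_pos.trans_le hR1
  have hC := hup.const_pos
  have hC₁ := hup.rate_pos
  have hA0 : 0 ≤ A := integral_nonneg fun t => (Real.exp_pos _).le
  have hRα : 2 * ((i : ℝ) + 1 + α₂) ≤ C₁ * α₂ * R ^ α₂ := by
    have h1 : 2 * ((r : ℝ) + 1 + α₂) / (C₁ * α₂) ≤ R ^ α₂ := by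
      have h0 : 0 ≤ 2 * ((r : ℝ) + 1 + α₂) / (C₁ * α₂) := by positivity
      calc _ = ((2 * ((r : ℝ) + 1 + α₂) / (C₁ * α₂)) ^ α₂⁻¹) ^ α₂ := by
            rw [← Real.rpow_mul h0, inv_mul_cancel₀ hα₂.ne', Real.rpow_one]
        _ ≤ R ^ α₂ := Real.rpow_le_rpow (by positivity) ((le_max_right _ _).trans hR) hα₂.le
    rw [div_le_iff₀ (by positivity)] at h1
    have h2 : (i : ℝ) ≤ r := by exact_mod_cast hir
    linarith
  have hh := integrable_norm_pow_mul_deconvWeight hα₁ hR0.le hf.integrable heven hlow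
  have hw : Integrable (deconvWeight f R) := by
    rw [← integrable_norm_iff (measurable_deconvWeight hf.integrable).aestronglyMeasurable]
    simpa using hh 0
  refine ⟨fun ω => contDiff_deconvEstimator hh hw _ i, fun θ hθ => ?_⟩
  set a : ℝ := 1 / ((n : ℝ) * (2 * Real.pi) ^ d) with ha
  set M : ℝ := (2 * R) ^ d * (R ^ i * (c⁻¹ * Real.exp (C₂ * (d * R ^ α₁)))) with hMdef
  have hφ : ∀ u : Fin i → Fin d, Measurable fun x => (trigIntegral
      (fun s => partialMultiplier u s * deconvWeight f R s) (θ - x)).re := fun u =>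
    (Complex.continuous_re.comp ((continuous_trigIntegral
      (integrable_partialMultiplier_mul (hh i) hw.1 u)).comp (by fun_prop))).measurable
  have hM : ∀ (u : Fin i → Fin d) x, |(trigIntegral
      (fun s => partialMultiplier u s * deconvWeight f R s) (θ - x)).re| ≤ M := fun u x =>
    ((Complex.abs_re_le_norm _).trans (norm_trigIntegral_le _ _)).trans
      (integral_norm_partialMultiplier_mul_deconvWeight_le hα₁ hR0.le heven hlow u)
  have hmem : ∀ u, MemLp (fun ω => nabla i (deconvEstimator f R fun j => X j ω) θ u) 2 P :=
    fun u => by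
      simp_rw [nabla_deconvEstimator_apply hh hw]
      exact memLp_const_mul_sum_comp hX.aemeasurable (hφ u) (hM u) _
  have hvar : ∀ u, Var[fun ω => nabla i (deconvEstimator f R fun j => X j ω) θ u; P] ≤
      a ^ 2 * (n * M ^ 2) := fun u => by
    simp_rw [nabla_deconvEstimator_apply hh hw]
    exact variance_const_mul_sum_comp_le hX.aemeasurable hX.indep (hφ u) (hM u) _
  have hint1 : ∀ u, Integrable (fun ω => nabla i (deconvEstimator f R fun j => X j ω) θ u) P :=
    fun u => (hmem u).integrable one_le_two
  refine ⟨Integrable.of_eval_piLp hint1, ?_, integrable_norm_sq_sub_integral hmem, ?_⟩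
  · refine maxNorm_le (by positivity) fun u => ?_
    rw [PiLp.sub_apply, eval_integral_piLp hint1,
      integral_nabla_deconvEstimator_apply hX hn hf heven hlow hgd hg hh hw,
      nablaWithin_apply_eq_trigIntegral hΘ hα₂ hgd.integrable hup hgr.contDiffOn.continuousOn hθ,
      ← mul_sub, abs_mul, abs_of_pos (by positivity), ← Complex.sub_re]
    calc _ ≤ ((2 * Real.pi) ^ d)⁻¹ * (C * (d * ((4 / (C₁ * α₂) *
          (R ^ ((i : ℝ) + 1 - α₂) * Real.exp (-(C₁ * R ^ α₂)))) * A ^ (d - 1)))) := by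
          gcongr
          exact (Complex.abs_re_le_norm _).trans
            (norm_trigIntegral_indicator_cube_sub_le hα₂ hgd.integrable hup u θ hR0 hRα)
      -- Raising the exponent to its maximum with `0` uses `R ≥ 1`.
      _ ≤ ((2 * Real.pi) ^ d)⁻¹ * (C * (d * ((4 / (C₁ * α₂) *
          (R ^ max ((i : ℝ) + 1 - α₂) 0 * Real.exp (-(C₁ * R ^ α₂)))) * A ^ (d - 1)))) := by
          gcongr
          exact le_max_left _ _
      _ = _ := by ring
  -- Summing the entry bounds gives `d^i a² n M²`, which is exactly the claimed right-hand side, as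
  -- `a²` contributes `1/n²`.
  · refine (integral_norm_sq_sub_integral_le hmem hvar).trans (le_of_eq ?_)
    have hn' : (n : ℝ) ≠ 0 := by positivity
    have hexp : Real.exp (C₂ * (d * R ^ α₁)) ^ 2 = Real.exp (2 * C₂ * d * R ^ α₁) := by
      rw [← Real.exp_nat_mul]
      congr 1
      push_cast
      ring
    rw [← hexp]
    simp only [Fintype.card_fun, Fintype.card_fin, ha, hMdef]
    push_cast
    field_simp
    ring
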